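/- A set $M\subset\mathbb{R}$ is called microscopic if for each $\varepsilon>0$ there is a sequence of intervals $(J_n)_{n\in\omega}$ with $M\subset\bigcup_{n\in\omega}J_n$ and $|J_n|\le\varepsilon^{n+1}$ for all $n\in\omega$, where $|J|$ denotes the length of $J$. Let $\mathcal{M}$ be the family of all microscopic subsets of $\mathbb{R}$, and let $$\mathrm{add}(\mathcal{M})=\min\Big\{\mathrm{card}(\mathcal{A}):\ \mathcal{A}\subset\mathcal{M},\ \bigcup\mathcal{A}\notin\mathcal{M}\Big\}$$ be its additivity. For $D\subset\omega$ let $\underline{d}(D)=\liminf_{j\to\infty}\frac{\mathrm{card}(D\cap\{0,\dots,j\})}{j+1}$. A set $M\subset\mathbb{R}$ admits a cover of lower asymptotic density zero if for each $\varepsilon>0$ there are $D\subset\omega$ with $\underline{d}(D)=0$ and intervals $(J_d)_{d\in D}$ covering $M$ with $|J_d|\le\varepsilon^{d+1}$ for all $d\in D$. **Theorem (ZFC).** The additivity of $\mathcal{M}$ is exactly $\omega_1$: $$\mathrm{add}(\mathcal{M})=\omega_1.$$ Moreover, families $(r_\alpha)_{\alpha<\omega_1}$ in $(0,1)$ with $r_\alpha-r_\beta\notin\mathbb{Q}$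 for all $\alpha\ne\beta$ exist, and there is a bounded microscopic set $X\subset\mathbb{R}$ that does not admit a cover of lower asymptotic density zero and such that, for every such family, the union $\bigcup_{\alpha<\omega_1}(r_\alpha+X)$ is not microscopic. -/

import Mathlib

open Set Filter Cardinal

noncomputable section

/-- `J` is an interval of the real line (open, closed or half-open, possibly degenerate or empty)
whose length is at most `c`. The length of an interval is its extended diameter, which is
`sup J - inf J` for a bounded nonempty interval, `0` for the empty set and `∞` for an unbounded
interval. -/
def IsIntervalOfLengthLE (J : Set ℝ) (c : ℝ) : Prop :=
  J.OrdConnected ∧ Metric.ediam J ≤ ENNReal.ofReal c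

/-- Microscopic sets: for each `ε > 0` there is a covering by intervals `J n`, `n ∈ ω`, with
`|J n| ≤ ε ^ (n + 1)`. -/
def IsMicroscopic (M : Set ℝ) : Prop :=
  ∀ ε : ℝ, 0 < ε → ∃ J : ℕ → Set ℝ,
    (∀ n, IsIntervalOfLengthLE (J n) (ε ^ (n + 1))) ∧ M ⊆ ⋃ n, J n

/-- The family of all microscopic subsets of the real line. -/
def microscopicIdeal : Set (Set ℝ) := {M | IsMicroscopic M}

/-- The additivity of a family `I` of sets of reals: the least cardinality of a subfamily of `I`
whose union is not in `I`. (If there is no such subfamily, the value is `0`; the value of `sInf`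
on a nonempty set of cardinals is its minimum.) -/
def additivity (I : Set (Set ℝ)) : Cardinal.{0} :=
  sInf {κ | ∃ A : Set (Set ℝ), A ⊆ I ∧ ⋃₀ A ∉ I ∧ #A = κ}

/-- Lower asymptotic density of `D ⊆ ω`: the lower limit of `card (D ∩ {0, …, j}) / (j + 1)`. -/
def lowerDensity (D : Set ℕ) : ℝ :=
  liminf (fun j : ℕ => ((D ∩ Set.Iio (j + 1)).ncard : ℝ) / ((j : ℝ) + 1)) atTop

/-- `M` admits a cover of lower asymptotic density `δ`: for each `ε > 0` there are `D ⊆ ω` of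
lower asymptotic density at most `δ` and intervals `J d`, `d ∈ D`, covering `M`, with
`|J d| ≤ ε ^ (d + 1)`. The values `J d` for `d ∉ D` are irrelevant. -/
def AdmitsCoverOfLowerDensity (M : Set ℝ) (δ : ℝ) : Prop :=
  ∀ ε : ℝ, 0 < ε → ∃ D : Set ℕ, lowerDensity D ≤ δ ∧ ∃ J : ℕ → Set ℝ,
    (∀ d ∈ D, IsIntervalOfLengthLE (J d) (ε ^ (d + 1))) ∧ M ⊆ ⋃ d ∈ D, J d

/-- A family of reals in `(0, 1)`, indexed by the ordinals below `ω₁`, whose members have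
pairwise irrational differences. -/
def IsIrrationallySpaced (r : Set.Iio (Ordinal.omega.{0} 1) → ℝ) : Prop :=
  (∀ α, r α ∈ Set.Ioo (0 : ℝ) 1) ∧ Pairwise fun α β => Irrational (r α - r β)

end

/-!
The set `X` is `IntervalTree.treeSet`, built from a tree of nested closed intervals whose nodes are
coded by natural numbers. The interval at a node `i` with parent `a` has length
`2 ^ (-(a + 1) * (i + 1))`, so the intervals at the nodes with parent at least `K` witness
microscopicity of `X` for `ε = 2 ^ (-K)`. On the other hand, the codes of the children of a fixed
node `s` have positive density, and their lengths are only `c ^ i` for a constant `c` depending on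
`s`.

Suppose that `r + X` is covered by intervals `J d`, `d ∈ D`, with `|J d| ≤ 64 ^ (-(d + 1))`.
Following the tree along nodes whose translated intervals avoid the comparatively long `J d`, one
must get stuck at some node `s` (`exists_childless_survivor`): all children of `s` are hit by some
`J d`. The children of `s` come in blocks of `q = 2 ^ n` well-spaced intervals, so at least `7q / 10`
different indices `d < hitBound s * q` are needed to hit the `n`-th block
(`card_image_hitting`). Hence `D` has positive lower density.

If the `J d` cover `r + X` for uncountably many `r`, then infinitely many of these `r` get stuck at
the same node `s`. The left endpoints in each block form a Sidon set: a nonzero difference occurs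
only once, and distinct differences are at least `len s / (4 * q ^ 3)` apart, which is much more
than the length of `J d` for `d + 1 ≥ q / 4`. So two different translations share at most one such index
(`eq_of_hitting_eq`), and the needs of sufficiently many translations exceed the `hitBound s * q`
available indices (`card_ne_of_forall_isHitting`). With `ℵ₁` translations this gives `add ≤ ℵ₁`; the
converse inequality is the fact that countable unions of microscopic sets are microscopic.
-/

noncomputable section

/-! ### A 2-adic coding of pairs -/

lemma padicValNat_two_pow_mul_odd (k m : ℕ) : padicValNat 2 (2 ^ k * (2 * m + 1)) = k := by
  rw [padicValNat.mul (by positivity) (by positivity), padicValNat.prime_pow,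
    padicValNat.eq_zero_of_not_dvd (by omega), add_zero]

lemma two_pow_mul_odd_div (k m : ℕ) : 2 ^ k * (2 * m + 1) / 2 ^ (k + 1) = m := by
  rw [pow_succ, Nat.mul_div_mul_left _ _ (by positivity)]
  omega

namespace IntervalTree

/-! ### A Sidon set -/

/-- The numbers `sidon q j`, `j < q`, form a Sidon set: a difference of two distinct elements
determines the pair. They grow only polynomially, at most up to `2 * q ^ 3`, and consecutive ones
are at least `2 * q ^ 2` apart. -/
def sidon (q j : ℕ) : ℕ := 2 * q ^ 2 * j + j ^ 2

lemma sidon_le {q j : ℕ} (hj : j < q) : sidon q j ≤ 2 * q ^ 3 := by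
  unfold sidon
  have : j + 1 ≤ q := hj
  nlinarith [Nat.mul_le_mul_left (2 * q ^ 2) this, Nat.pow_le_pow_left hj.le 2]

lemma sidon_sub_le {q i j : ℕ} (hij : i ≤ j) :
    2 * (q : ℝ) ^ 2 * (j - i) ≤ (sidon q j : ℝ) - sidon q i := by
  have h : (i : ℝ) ≤ j := by exact_mod_cast hij
  have h0 : (0 : ℝ) ≤ i := by positivity
  simp only [sidon]
  push_cast
  nlinarith

/-- Both summands can be read off from `(i + l) * 2q² + (i² + l²)`, because `i² + l² < 2q²`; the sum
and the sum of the squares of two numbers determine the two numbers. -/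
lemma sidon_add_eq {q i j k l : ℕ} (hi : i < q) (hj : j < q) (hk : k < q) (hl : l < q)
    (h : sidon q i + sidon q l = sidon q j + sidon q k) :
    (i = j ∧ l = k) ∨ (i = k ∧ l = j) := by
  unfold sidon at h
  have bi : ∀ {a : ℕ}, a < q → a ^ 2 < q ^ 2 := fun ha => Nat.pow_lt_pow_left ha two_ne_zero
  have h1 : (i + l) * (2 * q ^ 2) + (i ^ 2 + l ^ 2) = (j + k) * (2 * q ^ 2) + (j ^ 2 + k ^ 2) := by
    linarith
  have e1 : i ^ 2 + l ^ 2 < 2 * q ^ 2 := by linarith [bi hi, bi hl]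
  have e2 : j ^ 2 + k ^ 2 < 2 * q ^ 2 := by linarith [bi hj, bi hk]
  have hm : i ^ 2 + l ^ 2 = j ^ 2 + k ^ 2 := by
    have := congrArg (· % (2 * q ^ 2)) h1
    simpa [Nat.mod_eq_of_lt e1, Nat.mod_eq_of_lt e2] using this
  have hs : i + l = j + k := by
    have hq : 0 < 2 * q ^ 2 := by omega
    exact Nat.eq_of_mul_eq_mul_right hq (by omega)
  zify at hm hs ⊢
  have hp : ((i : ℤ) - j) * (i - k) = 0 := by
    rw [show (l : ℤ) = j + k - i by linarith] at hm
    linarith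
  rcases mul_eq_zero.1 hp with h | h
  · left; constructor <;> linarith
  · right; constructor <;> linarith

/-! ### The tree of intervals -/

/-- The nodes of an infinitely branching tree are coded by natural numbers, with root `0`; the parent
of a node `i ≠ 0` is its 2-adic valuation. In this way the children of each node have positive
asymptotic density in `ℕ`. (The value at the root is the junk value `0`.) -/
def parent (i : ℕ) : ℕ := padicValNat 2 i

/-- The `j`-th node of the `n`-th block of children of `s`, where `j < 2 ^ n`. The blocks exhaust
the children of `s` other than `2 ^ s`. -/
def child (s n j : ℕ) : ℕ := 2 ^ s * (2 * (2 ^ n + j) + 1)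

/-- The length of the interval at the node `i` is `2 ^ (-weight i)`. The factor `parent i + 1` makes
the intervals short enough for a microscopic set, yet it is constant on the children of a node. -/
def weight (i : ℕ) : ℕ := (parent i + 1) * (i + 1)

/-- The length of the interval at the node `i`. -/
def len (i : ℕ) : ℝ := (1 / 2) ^ weight i

/-- The position of the interval at the node `i` inside the interval of its parent, relative to the
length of the latter. For `i = child s n j` it is `sidon q j / (4 * q ^ 3)` with `q = 2 ^ n`. -/
def offset (i : ℕ) : ℝ :=
  let b := i / 2 ^ (parent i + 1)
  let q := 2 ^ Nat.log 2 b
  (sidon q (b - q) : ℝ) / (4 * (q : ℝ) ^ 3)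

lemma parent_lt {i : ℕ} (hi : i ≠ 0) : parent i < i :=
  Nat.lt_two_pow_self.trans_le (Nat.le_of_dvd (Nat.pos_of_ne_zero hi) pow_padicValNat_dvd)

lemma parent_le (i : ℕ) : parent i ≤ i := by
  rcases eq_or_ne i 0 with rfl | hi
  · simp [parent]
  · exact (parent_lt hi).le

/-- The left endpoint of the interval at the node `i`. -/
def pos (i : ℕ) : ℝ :=
  if _h : i = 0 then 0 else pos (parent i) + len (parent i) * offset i
termination_by i
decreasing_by exact parent_lt _h

/-- The closed interval at the node `i`; it is contained in the interval at the parent of `i`. -/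
def node (i : ℕ) : Set ℝ := Icc (pos i) (pos i + len i)

/-- The points that lie in the intervals of nodes with arbitrarily large parents. In particular,
it contains the intersection of the intervals along any infinite branch. -/
def treeSet : Set ℝ := {x | ∀ K, ∃ i, K ≤ parent i ∧ x ∈ node i}

lemma pos_eq {i : ℕ} (hi : i ≠ 0) : pos i = pos (parent i) + len (parent i) * offset i := by
  rw [pos, dif_neg hi]

lemma child_ne_zero (s n j : ℕ) : child s n j ≠ 0 := by simp [child]

lemma parent_child (s n j : ℕ) : parent (child s n j) = s :=
  padicValNat_two_pow_mul_odd s _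

lemma offset_child {s n j : ℕ} (hj : j < 2 ^ n) :
    offset (child s n j) = (sidon (2 ^ n) j : ℝ) / (4 * ((2 ^ n : ℕ) : ℝ) ^ 3) := by
  have hb : child s n j / 2 ^ (s + 1) = 2 ^ n + j := two_pow_mul_odd_div s _
  have hl : Nat.log 2 (2 ^ n + j) = n :=
    Nat.log_eq_of_pow_le_of_lt_pow (by omega) (by rw [pow_succ]; omega)
  simp only [offset, parent_child, hb, hl, Nat.add_sub_cancel_left]

lemma offset_nonneg (i : ℕ) : 0 ≤ offset i := by unfold offset; positivity

lemma offset_le (i : ℕ) : offset i ≤ 1 / 2 := by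
  have key : ∀ b : ℕ, b - 2 ^ Nat.log 2 b < 2 ^ Nat.log 2 b := fun b => by
    have := Nat.lt_pow_succ_log_self one_lt_two b
    rw [pow_succ] at this
    have : 0 < 2 ^ Nat.log 2 b := by positivity
    omega
  unfold offset
  simp only
  rw [div_le_iff₀ (by positivity)]
  have h : (_ : ℝ) ≤ _ := Nat.cast_le.2 (sidon_le (key (i / 2 ^ (parent i + 1))))
  push_cast at h ⊢
  linarith

lemma len_pos (i : ℕ) : 0 < len i := by unfold len; positivity

lemma len_le_half {i : ℕ} (hi : i ≠ 0) : len i ≤ len (parent i) / 2 := by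
  have h1 : weight (parent i) + 1 ≤ weight i := by
    unfold weight
    have h2 := parent_lt hi
    have h3 := parent_le (parent i)
    nlinarith [Nat.mul_le_mul_left (parent i + 1) h2, Nat.mul_le_mul_right (parent i + 1) h3]
  calc len i ≤ (1 / 2) ^ (weight (parent i) + 1) :=
        pow_le_pow_of_le_one (by norm_num) (by norm_num) h1
    _ = len (parent i) / 2 := by rw [pow_succ, len]; ring

lemma node_subset_parent {i : ℕ} (hi : i ≠ 0) : node i ⊆ node (parent i) := by
  have h1 := len_le_half hi
  have h2 := mul_nonneg (len_pos (parent i)).le (offset_nonneg i)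
  have h3 := mul_le_mul_of_nonneg_left (offset_le i) (len_pos (parent i)).le
  refine Icc_subset_Icc ?_ ?_ <;> rw [pos_eq hi] <;> linarith

lemma node_subset_zero (i : ℕ) : node i ⊆ node 0 := by
  induction i using Nat.strong_induction_on with
  | _ i ih =>
    rcases eq_or_ne i 0 with rfl | hi
    · exact subset_rfl
    · exact (node_subset_parent hi).trans (ih _ (parent_lt hi))

lemma isIntervalOfLengthLE_node {i : ℕ} {c : ℝ} (h : len i ≤ c) :
    IsIntervalOfLengthLE (node i) c :=
  ⟨ordConnected_Icc, by
    rw [node, Real.ediam_Icc, add_sub_cancel_left]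
    exact ENNReal.ofReal_le_ofReal h⟩

lemma isBounded_treeSet : Bornology.IsBounded treeSet :=
  (Metric.isBounded_Icc (pos 0) (pos 0 + len 0)).subset fun _ hx =>
    let ⟨i, _, hi⟩ := hx 0
    node_subset_zero i hi

lemma isMicroscopic_treeSet : IsMicroscopic treeSet := by
  intro ε hε
  obtain ⟨K, hK⟩ := exists_pow_lt_of_lt_one hε (by norm_num : (1 / 2 : ℝ) < 1)
  refine ⟨fun i => if K ≤ parent i then node i else ∅, fun i => ?_, fun x hx => ?_⟩
  · dsimp only
    split_ifs with h
    · refine isIntervalOfLengthLE_node ?_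
      calc len i ≤ (1 / 2) ^ (K * (i + 1)) :=
            pow_le_pow_of_le_one (by norm_num) (by norm_num)
              (Nat.mul_le_mul_right _ (h.trans (Nat.le_succ _)))
        _ = ((1 / 2) ^ K) ^ (i + 1) := pow_mul _ _ _
        _ ≤ ε ^ (i + 1) := pow_le_pow_left₀ (by positivity) hK.le _
    · exact ⟨ordConnected_empty, by simp⟩
  · obtain ⟨i, hi, hxi⟩ := hx K
    exact mem_iUnion.2 ⟨i, by simpa [hi] using hxi⟩

/-! ### Coverings of translates of the tree set -/

/-- The interval at `s`, translated by `r`, avoids all the sets `J d`, `d ∈ D`, with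
`d + 1 < weight s`. The other `J d` will be much shorter than that interval. -/
def Survives (D : Set ℕ) (J : ℕ → Set ℝ) (r : ℝ) (s : ℕ) : Prop :=
  ∀ d ∈ D, d + 1 < weight s → ∀ x ∈ node s, r + x ∉ J d

/-- Otherwise an infinite branch of surviving nodes starts at the root, and the point of `treeSet`
that it defines lies, after translation by `r`, in none of the sets `J d`. -/
lemma exists_childless_survivor {D : Set ℕ} {J : ℕ → Set ℝ} {r : ℝ}
    (h : ∀ x ∈ treeSet, ∃ d ∈ D, r + x ∈ J d) :
    ∃ s, Survives D J r s ∧ ∀ t, t ≠ 0 → parent t = s → ¬ Survives D J r t := by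
  by_contra! hcon
  choose! f hf0 hfp hfs using hcon
  let c : ℕ → ℕ := fun k => f^[k] 0
  have hc1 : ∀ k, c (k + 1) = f (c k) := fun k => Function.iterate_succ_apply' f k 0
  have hs : ∀ k, Survives D J r (c k) := fun k => by
    induction k with
    | zero => exact fun d _ hd => by simp [c, weight, parent] at hd
    | succ k ih => rw [hc1]; exact hfs _ ih
  have hp : ∀ k, parent (c (k + 1)) = c k := fun k => by rw [hc1]; exact hfp _ (hs k)
  have h0 : ∀ k, c (k + 1) ≠ 0 := fun k => by rw [hc1]; exact hf0 _ (hs k)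
  have hck : ∀ k, k ≤ c k := fun k => by
    induction k with
    | zero => exact Nat.zero_le _
    | succ k ih => have := parent_lt (h0 k); rw [hp] at this; omega
  obtain ⟨x, hx⟩ : (⋂ k, node (c k)).Nonempty :=
    IsCompact.nonempty_iInter_of_sequence_nonempty_isCompact_isClosed _
      (fun k => by have := node_subset_parent (h0 k); rwa [hp] at this)
      (fun k => nonempty_Icc.2 (by linarith [len_pos (c k)])) isCompact_Icc
      (fun k => isClosed_Icc)
  rw [mem_iInter] at hx
  obtain ⟨d, hd, hxd⟩ := h x fun K => ⟨c (K + 1), by rw [hp]; exact hck K, hx _⟩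
  refine hs (d + 2) d hd ?_ x (hx _) hxd
  have := hck (d + 2)
  unfold weight
  nlinarith [Nat.zero_le (parent (c (d + 2)) * (c (d + 2) + 1))]

/-- `hitBound s * 2 ^ n` bounds the weights of the nodes in the `n`-th block of children of `s`. -/
def hitBound (s : ℕ) : ℕ := (s + 1) * 2 ^ s * 4

lemma hitBound_pos (s : ℕ) : 0 < hitBound s := by unfold hitBound; positivity

lemma weight_child_le {s n j : ℕ} (hj : j < 2 ^ n) :
    weight (child s n j) ≤ hitBound s * 2 ^ n := by
  rw [weight, parent_child, hitBound, mul_assoc, mul_assoc]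
  refine Nat.mul_le_mul_left _ ?_
  have : 0 < 2 ^ s := by positivity
  unfold child
  nlinarith [Nat.mul_le_mul_left (2 ^ s) hj]

lemma len_child_le {s n j : ℕ} : len (child s n j) ≤ (1 / 2) ^ (2 ^ n) := by
  refine pow_le_pow_of_le_one (by norm_num) (by norm_num) ?_
  calc 2 ^ n ≤ 1 * (2 * (2 ^ n + j) + 1) := by omega
    _ ≤ child s n j := Nat.mul_le_mul_right _ Nat.one_le_two_pow
    _ ≤ 1 * (child s n j + 1) := by omega
    _ ≤ weight (child s n j) := Nat.mul_le_mul_right _ (Nat.succ_pos _)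

/-- `h` chooses, for each node of the `n`-th block of children of `s`, an index `d ∈ D` such that `J d`
meets the interval at that node translated by `r`. The lower bound on `d` says that `J d` is much
shorter than the interval at `s`, and the upper bound is linear in the size `2 ^ n` of the block. -/
structure IsHitting (D : Set ℕ) (J : ℕ → Set ℝ) (r : ℝ) (s n : ℕ) (h : ℕ → ℕ) : Prop where
  mem : ∀ j < 2 ^ n, h j ∈ D
  le : ∀ j < 2 ^ n, weight s ≤ h j + 1
  lt : ∀ j < 2 ^ n, h j < hitBound s * 2 ^ n
  hit : ∀ j < 2 ^ n, ∃ x ∈ node (child s n j), r + x ∈ J (h j)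

/-- Every child of a childless survivor is hit by some `J d`, and `d` is bounded below because the
survivor itself avoids `J d` for small `d`. -/
lemma exists_isHitting {D : Set ℕ} {J : ℕ → Set ℝ} {r : ℝ}
    (h : ∀ x ∈ treeSet, ∃ d ∈ D, r + x ∈ J d) :
    ∃ s, ∀ n, ∃ h, IsHitting D J r s n h := by
  obtain ⟨s, hs, hc⟩ := exists_childless_survivor h
  refine ⟨s, fun n => ?_⟩
  have key : ∀ j < 2 ^ n, ∃ d ∈ D, weight s ≤ d + 1 ∧ d < hitBound s * 2 ^ n ∧
      ∃ x ∈ node (child s n j), r + x ∈ J d := by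
    intro j hj
    have := hc _ (child_ne_zero s n j) (parent_child s n j)
    unfold Survives at this
    push Not at this
    obtain ⟨d, hd, hdt, x, hx, hxd⟩ := this
    refine ⟨d, hd, ?_, by have := weight_child_le (s := s) hj; omega, x, hx, hxd⟩
    by_contra! hlt
    have hsub := node_subset_parent (child_ne_zero s n j)
    rw [parent_child] at hsub
    exact hs d hd hlt x (hsub hx) hxd
  choose! h h1 h2 h3 h4 using key
  exact ⟨h, h1, h2, h3, h4⟩

/-- For `d ∈ D`, the diameter of `J d` is at most `64 ^ (-(d + 1))`. The base `1 / 64` is small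
compared with the base `1 / 2` of the lengths of the tree intervals. -/
def HasSmallDiam (D : Set ℕ) (J : ℕ → Set ℝ) : Prop :=
  ∀ d ∈ D, ∀ x ∈ J d, ∀ y ∈ J d, |x - y| ≤ (1 / 64) ^ (d + 1)

lemma hasSmallDiam_of_isIntervalOfLengthLE {D : Set ℕ} {J : ℕ → Set ℝ}
    (h : ∀ d ∈ D, IsIntervalOfLengthLE (J d) ((1 / 64) ^ (d + 1))) : HasSmallDiam D J := by
  intro d hd x hx y hy
  have h1 := (Metric.edist_le_ediam_of_mem hx hy).trans (h d hd).2
  rw [edist_dist] at h1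
  rw [← Real.dist_eq]
  exact (ENNReal.ofReal_le_ofReal_iff (by positivity)).1 h1

lemma pos_child {s n j : ℕ} (hj : j < 2 ^ n) :
    pos (child s n j) =
      pos s + len s * ((sidon (2 ^ n) j : ℝ) / (4 * ((2 ^ n : ℕ) : ℝ) ^ 3)) := by
  rw [pos_eq (child_ne_zero s n j), parent_child, offset_child hj]

/-- If the same `J d` is chosen for the node `i` under the translation by `r` and for the node `j`
under the translation by `r'`, then the translated nodes are close to each other. -/
lemma abs_pos_child_sub_le {D : Set ℕ} {J : ℕ → Set ℝ} (hJ : HasSmallDiam D J) {r r' : ℝ}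
    {s n i j : ℕ} {h h' : ℕ → ℕ} (hh : IsHitting D J r s n h) (hh' : IsHitting D J r' s n h')
    (hi : i < 2 ^ n) (hj : j < 2 ^ n) (hij : h i = h' j) :
    |(r + pos (child s n i)) - (r' + pos (child s n j))| ≤
      (1 / 64) ^ (h i + 1) + (1 / 2) ^ (2 ^ n) := by
  obtain ⟨x, ⟨hx1, hx2⟩, hxJ⟩ := hh.hit i hi
  obtain ⟨y, ⟨hy1, hy2⟩, hyJ⟩ := hh'.hit j hj
  rw [← hij] at hyJ
  have h1 := abs_le.1 (hJ _ (hh.mem i hi) _ hxJ _ hyJ)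
  have h2 := len_child_le (s := s) (n := n) (j := i)
  have h3 := len_child_le (s := s) (n := n) (j := j)
  rw [abs_le]
  constructor <;> linarith

lemma card_le_of_sub_le {S : Finset ℕ} {c : ℝ} (hc : 0 ≤ c)
    (h : ∀ i ∈ S, ∀ j ∈ S, i ≤ j → (j : ℝ) - i ≤ c) : (S.card : ℝ) ≤ 1 + c := by
  rcases S.eq_empty_or_nonempty with rfl | hS
  · simp; linarith
  have hsub : S ⊆ Finset.Icc (S.min' hS) (S.max' hS) := fun x hx =>
    Finset.mem_Icc.2 ⟨S.min'_le x hx, S.le_max' x hx⟩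
  have h1 := Finset.card_le_card hsub
  have h2 := S.min'_le_max' hS
  have h3 := h _ (S.min'_mem hS) _ (S.max'_mem hS) h2
  rw [Nat.card_Icc] at h1
  have h4 : S.card + S.min' hS ≤ S.max' hS + 1 := by omega
  have h5 : (S.card : ℝ) + S.min' hS ≤ S.max' hS + 1 := by exact_mod_cast h4
  linarith

/-- A hitting choice for a large block takes at least a fixed proportion of distinct values: a set
`J d` meets more than one interval of the block only in proportion to its length, and these lengths
have a sum that is small compared with the length of the interval at `s`. -/
lemma card_image_hitting {D : Set ℕ} {J : ℕ → Set ℝ} (hJ : HasSmallDiam D J) {r : ℝ}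
    {s n : ℕ} {h : ℕ → ℕ} (hh : IsHitting D J r s n h)
    (hn : 2 * (2 ^ n : ℕ) * (1 / 2 : ℝ) ^ (2 ^ n) ≤ len s / 4) :
    (7 / 10 : ℝ) * (2 ^ n : ℕ) ≤ ((Finset.range (2 ^ n)).image h).card := by
  set q : ℕ := 2 ^ n with hq
  have hq0 : (0 : ℝ) < q := by positivity
  have hl := len_pos s
  set E := (Finset.range q).image h with hE
  -- The points `pos (child s n j)` are at least `len s / (2 * q)` apart, so `J d` meets few of them.
  have fiber : ∀ d ∈ E, (((Finset.range q).filter fun j => h j = d).card : ℝ) ≤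
      5 / 4 + 2 * q / len s * (1 / 64) ^ (d + 1) := by
    intro d _
    have h1 : ((((Finset.range q).filter fun j => h j = d).card : ℕ) : ℝ) ≤
        1 + 2 * q / len s * ((1 / 64) ^ (d + 1) + (1 / 2) ^ q) := by
      refine card_le_of_sub_le (by positivity) fun i hi j hj hij => ?_
      simp only [Finset.mem_filter, Finset.mem_range] at hi hj
      have h2 := abs_le.1
        (abs_pos_child_sub_le hJ hh hh hj.1 hi.1 (hj.2.trans hi.2.symm))
      rw [pos_child hj.1, pos_child hi.1, hj.2, ← hq] at h2
      have h3 := sidon_sub_le (q := q) hij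
      have h4 : len s / (2 * q) * ((j : ℝ) - i) ≤ len s * (sidon q j / (4 * (q : ℝ) ^ 3)) -
          len s * (sidon q i / (4 * (q : ℝ) ^ 3)) := by
        calc len s / (2 * q) * ((j : ℝ) - i)
            = len s / (4 * (q : ℝ) ^ 3) * (2 * (q : ℝ) ^ 2 * (j - i)) := by field_simp; ring
          _ ≤ len s / (4 * (q : ℝ) ^ 3) * ((sidon q j : ℝ) - sidon q i) :=
              mul_le_mul_of_nonneg_left h3 (by positivity)
          _ = _ := by ring
      have h5 : len s / (2 * q) * ((j : ℝ) - i) ≤ (1 / 64) ^ (d + 1) + (1 / 2) ^ q := by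
        linarith [h2.2]
      calc (j : ℝ) - i = 2 * q / len s * (len s / (2 * q) * ((j : ℝ) - i)) := by field_simp
        _ ≤ _ := mul_le_mul_of_nonneg_left h5 (by positivity)
    have h6 : 2 * q / len s * (1 / 2 : ℝ) ^ q ≤ 1 / 4 := by
      rw [div_mul_eq_mul_div, div_le_iff₀ hl]; linarith
    rw [mul_add] at h1
    linarith
  have hsum : ∑ d ∈ E, (1 / 64 : ℝ) ^ (d + 1) ≤ len s / 16 := by
    have hsub : E.image (· + 1) ⊆ Finset.Ico (weight s) (hitBound s * q + 1) := by
      intro x hx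
      simp only [hE, Finset.mem_image, Finset.mem_range] at hx
      obtain ⟨_, ⟨j, hj, rfl⟩, rfl⟩ := hx
      exact Finset.mem_Ico.2 ⟨hh.le j hj, Nat.succ_lt_succ (hh.lt j hj)⟩
    have hw : 1 ≤ weight s := Nat.mul_pos (Nat.succ_pos _) (Nat.succ_pos _)
    calc ∑ d ∈ E, (1 / 64 : ℝ) ^ (d + 1) = ∑ i ∈ E.image (· + 1), (1 / 64 : ℝ) ^ i := by
          rw [Finset.sum_image (add_left_injective 1).injOn]
      _ ≤ ∑ i ∈ Finset.Ico (weight s) (hitBound s * q + 1), (1 / 64 : ℝ) ^ i :=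
          Finset.sum_le_sum_of_subset_of_nonneg hsub fun _ _ _ => by positivity
      _ ≤ (1 / 64 : ℝ) ^ weight s / (1 - 1 / 64) :=
          geom_sum_Ico_le_of_lt_one (by norm_num) (by norm_num)
      _ = len s * ((1 / 32 : ℝ) ^ weight s * (64 / 63)) := by
          rw [len, ← mul_assoc, ← mul_pow]; norm_num; ring
      _ ≤ len s * ((1 / 32 : ℝ) ^ 1 * (64 / 63)) := by
          gcongr ?_ * (?_ * _)
          exact pow_le_pow_of_le_one (by norm_num) (by norm_num) hw
      _ ≤ len s / 16 := by linarith
  have hcard : (q : ℝ) = ∑ d ∈ E, (((Finset.range q).filter fun j => h j = d).card : ℝ) := by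
    rw [← Nat.cast_sum, ← Finset.card_eq_sum_card_image, Finset.card_range]
  have htot : (q : ℝ) ≤ 5 / 4 * E.card + 2 * q / len s * (len s / 16) := by
    calc (q : ℝ) ≤ ∑ d ∈ E, (5 / 4 + 2 * q / len s * (1 / 64) ^ (d + 1)) :=
          hcard.trans_le (Finset.sum_le_sum fiber)
      _ = 5 / 4 * E.card + 2 * q / len s * ∑ d ∈ E, (1 / 64 : ℝ) ^ (d + 1) := by
          rw [Finset.sum_add_distrib, Finset.sum_const, nsmul_eq_mul, Finset.mul_sum]; ring
      _ ≤ _ := by gcongr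
  have : 2 * q / len s * (len s / 16) = (q : ℝ) / 8 := by field_simp; norm_num
  linarith

/-- Hitting choices for two different translations share at most one index `d` that is not small
compared with the size of the block: two shared indices give two pairs of elements of the Sidon set
with the same difference, and that difference can vanish only if `r` and `r'` are very close. -/
lemma eq_of_hitting_eq {D : Set ℕ} {J : ℕ → Set ℝ} (hJ : HasSmallDiam D J) {r r' : ℝ}
    {s n : ℕ} {h h' : ℕ → ℕ} (hh : IsHitting D J r s n h) (hh' : IsHitting D J r' s n h')
    (hr : 2 * (1 / 2 : ℝ) ^ (2 ^ n) < |r - r'|)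
    (hn : 16 * ((2 ^ n : ℕ) : ℝ) ^ 3 * (1 / 2 : ℝ) ^ (2 ^ n) < len s)
    {i j k l : ℕ} (hi : i < 2 ^ n) (hj : j < 2 ^ n) (hk : k < 2 ^ n) (hl : l < 2 ^ n)
    (hij : h i = h' j) (hkl : h k = h' l) (hbi : 2 ^ n ≤ 4 * (h i + 1))
    (hbk : 2 ^ n ≤ 4 * (h k + 1)) : i = k := by
  set q : ℕ := 2 ^ n with hq
  have hq0 : (0 : ℝ) < q := by positivity
  have small : ∀ {d : ℕ}, q ≤ 4 * (d + 1) → (1 / 64 : ℝ) ^ (d + 1) ≤ (1 / 2) ^ q := fun {d} hd => by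
    rw [show (1 / 64 : ℝ) = (1 / 2) ^ 6 by norm_num, ← pow_mul]
    exact pow_le_pow_of_le_one (by norm_num) (by norm_num) (by omega)
  have h1 := abs_le.1 (abs_pos_child_sub_le hJ hh hh' hi hj hij)
  have h2 := abs_le.1 (abs_pos_child_sub_le hJ hh hh' hk hl hkl)
  have s1 := small hbi
  have s2 := small hbk
  have hsid : sidon q i + sidon q l = sidon q k + sidon q j := by
    rw [pos_child hi, pos_child hj, ← hq] at h1
    rw [pos_child hk, pos_child hl, ← hq] at h2
    have h3 : len s / (4 * (q : ℝ) ^ 3) *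
        |((sidon q i : ℝ) + sidon q l) - (sidon q k + sidon q j)| ≤ 4 * (1 / 2) ^ q := by
      have h0 : 0 < len s / (4 * (q : ℝ) ^ 3) := div_pos (len_pos s) (by positivity)
      have h6 : len s / (4 * (q : ℝ) ^ 3) * (((sidon q i : ℝ) + sidon q l) - (sidon q k + sidon q j)) =
          (len s * (sidon q i / (4 * (q : ℝ) ^ 3)) - len s * (sidon q j / (4 * (q : ℝ) ^ 3))) -
          (len s * (sidon q k / (4 * (q : ℝ) ^ 3)) - len s * (sidon q l / (4 * (q : ℝ) ^ 3))) := by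
        ring
      have h7 := abs_mul (len s / (4 * (q : ℝ) ^ 3))
        (((sidon q i : ℝ) + sidon q l) - (sidon q k + sidon q j))
      rw [abs_of_pos h0] at h7
      rw [← h7, h6, abs_le]
      constructor <;> linarith
    have h4 : |((sidon q i : ℝ) + sidon q l) - (sidon q k + sidon q j)| < 1 := by
      rw [div_mul_eq_mul_div, div_le_iff₀ (by positivity)] at h3
      by_contra! hge
      have := mul_le_mul_of_nonneg_left hge (len_pos s).le
      linarith
    have h5 : |(((sidon q i + sidon q l : ℕ) : ℤ) - (sidon q k + sidon q j : ℕ))| < 1 := by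
      rify; exact h4
    rw [Int.abs_lt_one_iff] at h5
    omega
  rcases sidon_add_eq hi hk hj hl hsid with h | h
  · exact h.1
  · exfalso
    rw [h.1, ← hq] at h1
    rw [h.1] at s1
    have : |r - r'| ≤ 2 * (1 / 2 : ℝ) ^ q := by
      rw [abs_le]; constructor <;> linarith
    linarith

/-! ### Counting the indices used by several translations -/

lemma tendsto_pow_mul_half_pow_two_pow (k : ℕ) :
    Tendsto (fun n : ℕ => ((2 ^ n : ℕ) : ℝ) ^ k * (1 / 2 : ℝ) ^ (2 ^ n)) atTop (nhds 0) :=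
  (tendsto_pow_const_mul_const_pow_of_abs_lt_one k (r := 1 / 2)
    (by rw [abs_of_pos] <;> norm_num)).comp (tendsto_pow_atTop_atTop_of_one_lt one_lt_two)

lemma eventually_card_image_hitting {D : Set ℕ} {J : ℕ → Set ℝ} (hJ : HasSmallDiam D J) (s : ℕ) :
    ∀ᶠ n in atTop, ∀ r h, IsHitting D J r s n h →
      (7 / 10 : ℝ) * (2 ^ n : ℕ) ≤ ((Finset.range (2 ^ n)).image h).card := by
  filter_upwards [(tendsto_pow_mul_half_pow_two_pow 1).eventually_lt_const
    (show 0 < len s / 8 from div_pos (len_pos s) (by norm_num))] with n hn r h hh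
  exact card_image_hitting hJ hh (by rw [pow_one] at hn; linarith)

/-- If too many translations used the same node `s`, their sets of chosen indices, almost disjoint
and each containing a fixed proportion of `2 ^ n` elements, would not fit below
`hitBound s * 2 ^ n`. -/
lemma card_ne_of_forall_isHitting {D : Set ℕ} {J : ℕ → Set ℝ} (hJ : HasSmallDiam D J) {s : ℕ}
    {S : Finset ℝ} (hS : ∀ r ∈ S, ∀ n, ∃ h, IsHitting D J r s n h) :
    S.card ≠ 4 * hitBound s := by
  intro hK
  have e3 : ∀ᶠ n in atTop, ∀ r ∈ S, ∀ r' ∈ S, r ≠ r' →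
      2 * (1 / 2 : ℝ) ^ (2 ^ n) < |r - r'| := by
    simp only [eventually_all_finset, eventually_imp_distrib_left]
    intro r _ r' _ hne
    filter_upwards [(tendsto_pow_mul_half_pow_two_pow 0).eventually_lt_const
      (show 0 < |r - r'| / 2 from div_pos (abs_pos.2 (sub_ne_zero.2 hne)) (by norm_num))] with n hn
    rw [pow_zero] at hn
    linarith
  have e4 : ∀ᶠ n in atTop, 16 * ((2 ^ n : ℕ) : ℝ) ^ 3 * (1 / 2 : ℝ) ^ (2 ^ n) < len s := by
    filter_upwards [(tendsto_pow_mul_half_pow_two_pow 3).eventually_lt_const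
      (show 0 < len s / 16 from div_pos (len_pos s) (by norm_num))] with n hn
    linarith
  have e5 : ∀ᶠ n in atTop, 20 * hitBound s < 2 ^ n :=
    (tendsto_pow_atTop_atTop_of_one_lt Nat.one_lt_two).eventually_gt_atTop _
  obtain ⟨n, h1, h3, h4, h5⟩ :=
    ((eventually_card_image_hitting hJ s).and (e3.and (e4.and e5))).exists
  choose! h hh using fun r hr => hS r hr n
  set q : ℕ := 2 ^ n with hq
  -- `E r` consists of the indices chosen for `r` that are not small, and `F r` of those among them
  -- that are chosen for no other element of `S`.
  let E : ℝ → Finset ℕ := fun r => ((Finset.range q).image (h r)).filter fun d => q ≤ 4 * (d + 1)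
  let F : ℝ → Finset ℕ := fun r => E r \ (S.erase r).biUnion fun r' => E r ∩ E r'
  have memE : ∀ {r d}, d ∈ E r → ∃ j < q, h r j = d ∧ q ≤ 4 * (d + 1) := by
    intro r d hd
    simp only [E, Finset.mem_filter, Finset.mem_image, Finset.mem_range] at hd
    obtain ⟨⟨j, hj, hjd⟩, hdq⟩ := hd
    exact ⟨j, hj, hjd, hdq⟩
  have cardE : ∀ r ∈ S, (9 / 20 : ℝ) * q ≤ (E r).card := by
    intro r hr
    have hsplit := Finset.card_filter_add_card_filter_not (s := (Finset.range q).image (h r))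
      fun d => q ≤ 4 * (d + 1)
    have hsmall : (((Finset.range q).image (h r)).filter fun d => ¬ q ≤ 4 * (d + 1)).card ≤
        q / 4 := by
      refine (Finset.card_le_card fun d hd => ?_).trans_eq (Finset.card_range _)
      rw [Finset.mem_filter] at hd
      rw [Finset.mem_range]
      omega
    have hle : ((Finset.range q).image (h r)).card ≤ (E r).card + q / 4 := by
      rw [← hsplit]; exact Nat.add_le_add_left hsmall _
    have hle' : (((Finset.range q).image (h r)).card : ℝ) ≤ (E r).card + (q : ℝ) / 4 := by
      refine (Nat.cast_le.2 hle).trans ?_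
      push_cast
      gcongr
      exact Nat.cast_div_le
    have := h1 r (h r) (hh r hr)
    linarith
  have cardF : ∀ r ∈ S, (9 / 20 : ℝ) * q - S.card ≤ (F r).card := by
    intro r hr
    have hb : ((S.erase r).biUnion fun r' => E r ∩ E r').card ≤ S.card := by
      refine (Finset.card_biUnion_le_card_mul _ _ 1 fun r' hr' => ?_).trans
        (by rw [mul_one]; exact Finset.card_le_card (Finset.erase_subset _ _))
      rw [Finset.mem_erase] at hr'
      refine Finset.card_le_one.2 fun d hd d' hd' => ?_
      rw [Finset.mem_inter] at hd hd'
      obtain ⟨i, hi, hid, hdq⟩ := memE hd.1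
      obtain ⟨j, hj, hjd, -⟩ := memE hd.2
      obtain ⟨k, hk, hkd, hdq'⟩ := memE hd'.1
      obtain ⟨l, hl, hld, -⟩ := memE hd'.2
      rw [← hid, ← hkd, eq_of_hitting_eq hJ (hh r hr) (hh r' hr'.2) (h3 r hr r' hr'.2 hr'.1.symm)
        h4 hi hj hk hl (hid.trans hjd.symm) (hkd.trans hld.symm) (by rw [hid]; exact hdq)
        (by rw [hkd]; exact hdq')]
    have hs := Finset.le_card_sdiff ((S.erase r).biUnion fun r' => E r ∩ E r') (E r)
    have hs' : (E r).card ≤ (F r).card + S.card := by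
      have : (E r).card - ((S.erase r).biUnion fun r' => E r ∩ E r').card ≤ (F r).card := hs
      omega
    have hs'' : ((E r).card : ℝ) ≤ (F r).card + S.card := by exact_mod_cast hs'
    linarith [cardE r hr]
  have disjF : (S : Set ℝ).PairwiseDisjoint F := by
    intro r hr r' hr' hne
    refine Finset.disjoint_left.2 fun d hd hd' => ?_
    simp only [F, Finset.mem_sdiff, Finset.mem_biUnion, not_exists, not_and] at hd hd'
    exact hd.2 r' (Finset.mem_erase.2 ⟨hne.symm, hr'⟩) (Finset.mem_inter.2 ⟨hd.1, hd'.1⟩)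
  have hsub : S.biUnion F ⊆ Finset.range (hitBound s * q) := by
    intro d hd
    obtain ⟨r, hr, hdr⟩ := Finset.mem_biUnion.1 hd
    obtain ⟨j, hj, rfl, -⟩ := memE (Finset.sdiff_subset hdr)
    exact Finset.mem_range.2 ((hh r hr).lt j hj)
  have hcard := Finset.card_le_card hsub
  rw [Finset.card_biUnion disjF, Finset.card_range] at hcard
  have hsum : (S.card : ℝ) * ((9 / 20 : ℝ) * q - S.card) ≤ hitBound s * q := by
    calc (S.card : ℝ) * ((9 / 20 : ℝ) * q - S.card) = ∑ r ∈ S, ((9 / 20 : ℝ) * q - S.card) := by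
          rw [Finset.sum_const, nsmul_eq_mul]
      _ ≤ ∑ r ∈ S, ((F r).card : ℝ) := Finset.sum_le_sum cardF
      _ ≤ hitBound s * q := by exact_mod_cast hcard
  rw [hK] at hsum
  push_cast at hsum
  have hC : (0 : ℝ) < hitBound s := by exact_mod_cast hitBound_pos s
  have h5' : (20 : ℝ) * hitBound s < q := by exact_mod_cast h5
  nlinarith [mul_lt_mul_of_pos_left h5' hC]

/-- Uncountably many translates cannot be distributed over countably many nodes `s` without
infinitely many of them sharing one. -/
lemma not_isMicroscopic_iUnion_translate {ι : Type*} [Uncountable ι] {r : ι → ℝ}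
    (hr : Function.Injective r) : ¬ IsMicroscopic (⋃ α, (fun x => r α + x) '' treeSet) := by
  intro hM
  obtain ⟨J, hJ, hcov⟩ := hM (1 / 64) (by norm_num)
  have hJ' : HasSmallDiam univ J := hasSmallDiam_of_isIntervalOfLengthLE fun d _ => hJ d
  have key : ∀ α, ∃ s, ∀ n, ∃ h, IsHitting univ J (r α) s n h := fun α =>
    exists_isHitting fun x hx => by
      obtain ⟨d, hd⟩ := mem_iUnion.1 (hcov (mem_iUnion.2 ⟨α, x, hx, rfl⟩))
      exact ⟨d, mem_univ d, hd⟩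
  choose s hs using key
  obtain ⟨t, ht⟩ : ∃ t, (s ⁻¹' {t}).Infinite := by
    by_contra! hfin
    refine not_countable_univ (α := ι) ((countable_iUnion fun t => (hfin t).countable).mono ?_)
    exact fun α _ => mem_iUnion.2 ⟨s α, rfl⟩
  obtain ⟨S, hSt, hScard⟩ := ht.exists_subset_card_eq (4 * hitBound t)
  refine card_ne_of_forall_isHitting hJ' (s := t) (S := S.map ⟨r, hr⟩) ?_ (by simpa using hScard)
  simp only [Finset.mem_map, Function.Embedding.coeFn_mk]
  rintro _ ⟨α, hα, rfl⟩
  have : s α = t := hSt hα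
  exact this ▸ hs α

/-! ### Lower density of the index set -/

/-- It suffices to bound the counting function of `D` from below along a geometric progression. -/
lemma lowerDensity_pos {D : Set ℕ} {C : ℕ} (hC : 0 < C) {c : ℝ} (hc : 0 < c)
    (h : ∀ᶠ n in atTop, c * (2 ^ n : ℕ) ≤ ((D ∩ Iio (C * 2 ^ n)).ncard : ℝ)) :
    0 < lowerDensity D := by
  have hC' : (0 : ℝ) < C := by exact_mod_cast hC
  have hle : ∀ j : ℕ, ((D ∩ Iio (j + 1)).ncard : ℝ) / ((j : ℝ) + 1) ≤ 1 := fun j => by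
    rw [div_le_one (by positivity)]
    have := ncard_le_ncard (inter_subset_right (s := D) (t := Iio (j + 1))) (finite_Iio _)
    rw [ncard_eq_toFinset_card' (Iio _), toFinset_Iio, Nat.card_Iio] at this
    exact_mod_cast this
  refine (show 0 < c / (2 * C) by positivity).trans_le
    (le_liminf_of_le (isBoundedUnder_of ⟨1, hle⟩).isCoboundedUnder_ge ?_)
  obtain ⟨N, hN⟩ := eventually_atTop.1 h
  filter_upwards [eventually_ge_atTop (C * 2 ^ N)] with j hj
  set n := Nat.log 2 ((j + 1) / C) with hn
  have hm : (j + 1) / C ≠ 0 := by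
    have : C ≤ j + 1 := (Nat.le_mul_of_pos_right C (by positivity)).trans (hj.trans (by omega))
    exact (Nat.div_pos this hC).ne'
  have h1 : C * 2 ^ n ≤ j + 1 := by
    rw [mul_comm]; exact (Nat.le_div_iff_mul_le hC).1 (Nat.pow_log_le_self 2 hm)
  have h2 : j + 1 < 2 ^ (n + 1) * C :=
    (Nat.div_lt_iff_lt_mul hC).1 (Nat.lt_pow_succ_log_self one_lt_two _)
  have h3 : N ≤ n := by
    refine Nat.le_log_of_pow_le one_lt_two ((Nat.le_div_iff_mul_le hC).2 ?_)
    rw [mul_comm]; omega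
  have h4 := hN n h3
  have h5 : ((D ∩ Iio (C * 2 ^ n)).ncard : ℝ) ≤ (D ∩ Iio (j + 1)).ncard := by
    exact_mod_cast ncard_le_ncard (inter_subset_inter_right _ (Iio_subset_Iio h1))
      ((finite_Iio _).inter_of_right _)
  have h6 : (j : ℝ) + 1 ≤ 2 * C * (2 ^ n : ℕ) := by
    rw [pow_succ] at h2
    have : j + 1 ≤ 2 * C * 2 ^ n := by nlinarith
    exact_mod_cast this
  rw [le_div_iff₀ (by positivity)]
  calc c / (2 * C) * ((j : ℝ) + 1) ≤ c / (2 * C) * (2 * C * (2 ^ n : ℕ)) := by gcongr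
    _ = c * (2 ^ n : ℕ) := by field_simp
    _ ≤ _ := h4.trans h5

lemma not_admitsCoverOfLowerDensity_treeSet : ¬ AdmitsCoverOfLowerDensity treeSet 0 := by
  intro hA
  obtain ⟨D, hD, J, hJ, hcov⟩ := hA (1 / 64) (by norm_num)
  have hJ' := hasSmallDiam_of_isIntervalOfLengthLE hJ
  obtain ⟨s, hs⟩ := exists_isHitting (D := D) (J := J) (r := 0) fun x hx => by
    simpa using hcov hx
  refine hD.not_gt (lowerDensity_pos (hitBound_pos s) (c := 7 / 10) (by norm_num) ?_)
  filter_upwards [eventually_card_image_hitting hJ' s] with n hn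
  obtain ⟨h, hh⟩ := hs n
  refine (hn 0 h hh).trans ?_
  rw [← ncard_coe_finset]
  refine Nat.cast_le.2 (ncard_le_ncard ?_ ((finite_Iio _).inter_of_right _))
  intro d hd
  obtain ⟨j, hj, rfl⟩ := Finset.mem_image.1 (Finset.mem_coe.1 hd)
  rw [Finset.mem_range] at hj
  exact ⟨hh.mem j hj, hh.lt j hj⟩

end IntervalTree

/-! ### Countable unions and translates of microscopic sets -/

lemma IsIntervalOfLengthLE.mono {J : Set ℝ} {c c' : ℝ} (h : IsIntervalOfLengthLE J c)
    (hc : c ≤ c') : IsIntervalOfLengthLE J c' :=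
  ⟨h.1, h.2.trans (ENNReal.ofReal_le_ofReal hc)⟩

lemma IsMicroscopic.iUnion {M : ℕ → Set ℝ} (hM : ∀ k, IsMicroscopic (M k)) :
    IsMicroscopic (⋃ k, M k) := by
  intro ε hε
  set η := min ε 1 with hη
  have hη0 : 0 < η := lt_min hε one_pos
  choose J hJ hcov using fun k => hM k (η ^ 2 ^ (k + 1)) (by positivity)
  refine ⟨fun i => J (padicValNat 2 (i + 1)) ((i + 1) / 2 ^ (padicValNat 2 (i + 1) + 1)),
    fun i => ?_, ?_⟩
  -- With `k = v₂(i + 1)` and `n = ⌊(i + 1) / 2 ^ (k + 1)⌋`, the index `n + 1` for the accuracy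
  -- `η ^ 2 ^ (k + 1)` is good enough because `2 ^ (k + 1) * (n + 1) > i + 1`.
  · refine (hJ _ _).mono ?_
    set k := padicValNat 2 (i + 1)
    rw [← pow_mul]
    refine (pow_le_pow_of_le_one hη0.le (min_le_right _ _) ?_).trans
      (pow_le_pow_left₀ hη0.le (min_le_left _ _) _)
    have := Nat.lt_div_mul_add (a := i + 1) (b := 2 ^ (k + 1)) (by positivity)
    nlinarith
  · refine iUnion_subset fun k x hx => ?_
    obtain ⟨n, hn⟩ := mem_iUnion.1 (hcov k hx)
    refine mem_iUnion.2 ⟨2 ^ k * (2 * n + 1) - 1, ?_⟩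
    have h1 : 2 ^ k * (2 * n + 1) - 1 + 1 = 2 ^ k * (2 * n + 1) :=
      Nat.sub_add_cancel (Nat.mul_pos (by positivity) (by omega))
    simpa only [h1, padicValNat_two_pow_mul_odd, two_pow_mul_odd_div] using hn

lemma isMicroscopic_empty : IsMicroscopic ∅ :=
  fun _ _ => ⟨fun _ => ∅, fun _ => ⟨ordConnected_empty, by simp⟩, empty_subset _⟩

lemma IsMicroscopic.sUnion {A : Set (Set ℝ)} (hA : A.Countable) (h : ∀ M ∈ A, IsMicroscopic M) :
    IsMicroscopic (⋃₀ A) := by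
  rcases A.eq_empty_or_nonempty with rfl | hne
  · simpa using isMicroscopic_empty
  obtain ⟨f, rfl⟩ := hA.exists_eq_range hne
  rw [sUnion_range]
  exact .iUnion fun k => h _ (mem_range_self k)

lemma IsMicroscopic.translate {M : Set ℝ} (hM : IsMicroscopic M) (r : ℝ) :
    IsMicroscopic ((fun x => r + x) '' M) := by
  intro ε hε
  obtain ⟨J, hJ, hcov⟩ := hM ε hε
  refine ⟨fun n => (fun x => r + x) '' J n, fun n => ⟨?_, ?_⟩, ?_⟩
  · have := (hJ n).1
    simp only [image_add_left]
    exact this.preimage_mono fun a b h => by simpa using h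
  · rw [(isometry_add_left r).ediam_image]
    exact (hJ n).2
  · rw [← image_iUnion]
    exact image_mono hcov

/-! ### Irrationally spaced families -/

/-- The quotient `ℝ / ℚ` is uncountable, hence has at least `ℵ₁` elements. -/
lemma exists_injective_quotient :
    ∃ f : Iio (Ordinal.omega.{0} 1) → ℝ ⧸ (Rat.castHom ℝ).range.toAddSubgroup,
      Function.Injective f := by
  set Q := (Rat.castHom ℝ).range.toAddSubgroup
  have hQ : #Q ≤ ℵ₀ := by
    have : Countable Q := (countable_range (Rat.castHom ℝ)).to_subtype
    exact mk_le_aleph0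
  have h1 : #ℝ = #(ℝ ⧸ Q) * #Q := by
    rw [mk_congr (AddSubgroup.addGroupEquivQuotientProdAddSubgroup (s := Q)), mk_prod, lift_id,
      lift_id]
  have h2 : ℵ_ 1 ≤ #(ℝ ⧸ Q) := by
    by_contra! hlt
    rw [lt_aleph_one_iff] at hlt
    have := (mul_le_mul' hlt hQ).trans_eq aleph0_mul_aleph0
    rw [← h1, mk_real] at this
    exact this.not_gt aleph0_lt_continuum
  have h3 : lift.{0} #(Iio (Ordinal.omega.{0} 1)) ≤ lift.{1} #(ℝ ⧸ Q) := by
    rw [mk_Iio_ordinal, Ordinal.card_omega, lift_id'.{0, 1}]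
    exact lift_le.2 h2
  obtain ⟨f⟩ := lift_mk_le'.1 h3
  exact ⟨f, f.injective⟩

lemma exists_isIrrationallySpaced :
    ∃ r : Iio (Ordinal.omega.{0} 1) → ℝ, IsIrrationallySpaced r := by
  obtain ⟨f, hf⟩ := exists_injective_quotient
  have hrep : ∀ y : ℝ ⧸ (Rat.castHom ℝ).range.toAddSubgroup,
      ∃ x ∈ Ioo (0 : ℝ) 1, (x : ℝ ⧸ (Rat.castHom ℝ).range.toAddSubgroup) = y := by
    intro y
    obtain ⟨x, rfl⟩ := QuotientAddGroup.mk_surjective y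
    obtain ⟨p, hp1, hp2⟩ := exists_rat_btwn (sub_one_lt x)
    refine ⟨x - p, ⟨by linarith, by linarith⟩, ?_⟩
    rw [QuotientAddGroup.eq]
    exact ⟨p, by simp⟩
  choose g hg hgy using hrep
  refine ⟨fun α => g (f α), fun α => hg _, fun α β hne => ?_⟩
  rintro ⟨p, hp⟩
  refine hne (hf ?_)
  rw [← hgy (f α), ← hgy (f β), eq_comm, QuotientAddGroup.eq]
  exact ⟨p, by simp [hp]; ring⟩

lemma IsIrrationallySpaced.injective {r : Iio (Ordinal.omega.{0} 1) → ℝ}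
    (hr : IsIrrationallySpaced r) : Function.Injective r := by
  intro α β h
  by_contra hne
  exact (hr.2 hne).ne_zero (sub_eq_zero.2 h)

lemma uncountable_Iio_omega_one : Uncountable (Iio (Ordinal.omega.{0} 1)) := by
  rw [← aleph0_lt_mk_iff, mk_Iio_ordinal, Ordinal.card_omega, aleph0_lt_lift]
  exact aleph0_lt_aleph_one

end

/-! ### The additivity of the microscopic ideal -/

theorem theorem3p2 :
    additivity microscopicIdeal = Cardinal.aleph 1 ∧
    (∃ r : Set.Iio (Ordinal.omega.{0} 1) → ℝ, IsIrrationallySpaced r) ∧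
    ∃ X : Set ℝ, Bornology.IsBounded X ∧ IsMicroscopic X ∧ ¬ AdmitsCoverOfLowerDensity X 0 ∧
      ∀ r : Set.Iio (Ordinal.omega.{0} 1) → ℝ, IsIrrationallySpaced r →
        ¬ IsMicroscopic (⋃ α, (fun x => r α + x) '' X) := by
  have := uncountable_Iio_omega_one
  have hX : ∀ r : Set.Iio (Ordinal.omega.{0} 1) → ℝ, IsIrrationallySpaced r →
      ¬ IsMicroscopic (⋃ α, (fun x => r α + x) '' IntervalTree.treeSet) := fun r hr =>
    IntervalTree.not_isMicroscopic_iUnion_translate hr.injective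
  refine ⟨?_, exists_isIrrationallySpaced, IntervalTree.treeSet, IntervalTree.isBounded_treeSet,
    IntervalTree.isMicroscopic_treeSet, IntervalTree.not_admitsCoverOfLowerDensity_treeSet, hX⟩
  obtain ⟨r, hr⟩ := exists_isIrrationallySpaced
  set A := range fun α => (fun x => r α + x) '' IntervalTree.treeSet with hA
  have hmem : #A ∈ {κ | ∃ A : Set (Set ℝ), A ⊆ microscopicIdeal ∧ ⋃₀ A ∉ microscopicIdeal ∧
      #A = κ} := by
    refine ⟨A, ?_, ?_, rfl⟩
    · rintro _ ⟨α, rfl⟩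
      exact IntervalTree.isMicroscopic_treeSet.translate _
    · rw [hA, sUnion_range]
      exact hX r hr
  refine le_antisymm ((csInf_le' hmem).trans ?_) (le_csInf ⟨_, hmem⟩ ?_)
  · have h := mk_range_le_lift (f := fun α => (fun x => r α + x) '' IntervalTree.treeSet)
    rw [mk_Iio_ordinal, Ordinal.card_omega, lift_id'.{0, 1}] at h
    exact lift_le.1 h
  · rintro _ ⟨B, hB, hBU, rfl⟩
    by_contra! hlt
    rw [lt_aleph_one_iff, le_aleph0_iff_set_countable] at hlt
    exact hBU (IsMicroscopic.sUnion hlt hB)
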